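/- For a finite sequence of positive integers define the continuant by $\langle\varnothing\rangle=1$, $\langle a_1\rangle=a_1$ and $\langle a_1,\dots,a_{j+1}\rangle=a_{j+1}\langle a_1,\dots,a_j\rangle+\langle a_1,\dots,a_{j-1}\rangle$ for $j\ge 1$. For positive integers $n,S$ let $U_n(S)$ be the set of all finite sequences (of any length $t$) with entries in $\{1,\dots,n\}$ and $a_1+\dots+a_t=S$, and put $$\mu_n=\frac{n+2+\sqrt{n^2+4n}}{2}.$$ For all integers $n,S$ with $2\le n\le S-2$, the minimum of the continuant over $U_n(S)$ exists and satisfies $$\min_{(a_1,\dots,a_t)\in U_n(S)}\langle a_1,\dots,a_t\rangle\ \ge\ \frac{\bigl(\mu_n^{1/(n+1)}\bigr)^{S-n+1}}{e^2}.$$ Moreover, for $n=4$ this bound improves the previously used lower bound $\bigl(\sqrt{2+10^{-6}}\bigr)^S$ for large $S$: one has $\sqrt{2+10^{-6}}<\mu_4^{1/5}$, and $$\bigl(\sqrt{2+10^{-6}}\bigr)^S<\frac{\bigl(\mu_4^{1/5}\bigr)^{S-3}}{e^2}\qquad\text{for every integer } S\ge 512.$$ -/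

import Mathlib

namespace Kan

/-- The continuant of a finite sequence whose entries are listed from last to first. -/
def continuantRev : List ℕ → ℕ
  | [] => 1
  | [a] => a
  | b :: a :: l => b * continuantRev (a :: l) + continuantRev l

/-- The continuant `⟨a₁, …, aₜ⟩` of a finite sequence of natural numbers. -/
def continuant (l : List ℕ) : ℕ := continuantRev l.reverse

theorem continuant_nil : continuant [] = 1 := rfl

theorem continuant_singleton (a : ℕ) : continuant [a] = a := rfl

/-- The recursion that defines continuants, `a` and `b` being the last two entries. -/
theorem continuant_append_pair (l : List ℕ) (a b : ℕ) :
    continuant (l ++ [a, b]) = b * continuant (l ++ [a]) + continuant l := by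
  simp [continuant, continuantRev]

/-- `U(S, t, n)`: the sequences of length `t` with entries in `{1, …, n}` and with sum `S`. -/
def sumLengthBoundedSeqs (S t n : ℕ) : Set (List ℕ) :=
  {l | l.length = t ∧ (∀ a ∈ l, 1 ≤ a ∧ a ≤ n) ∧ l.sum = S}

/-- `Uₙ(S)`: the sequences of any length with entries in `{1, …, n}` and with sum `S`. -/
def sumBoundedSeqs (n S : ℕ) : Set (List ℕ) :=
  ⋃ t : ℕ, sumLengthBoundedSeqs S t n

/-- `μₙ = (n + 2 + √(n² + 4n)) / 2`. -/
noncomputable def mu (n : ℕ) : ℝ :=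
  ((n : ℝ) + 2 + Real.sqrt ((n : ℝ) ^ 2 + 4 * n)) / 2

/-- The lower bound `(μₙ^{1/(n+1)})^{S-n+1} / e²`, with real exponents. -/
noncomputable def lowerBound (n S : ℕ) : ℝ :=
  (mu n ^ (1 / ((n : ℝ) + 1))) ^ ((S : ℝ) - n + 1) / Real.exp 1 ^ 2

end Kan

/-!
The sequence `n, 1, n, 1, …` has the slowest growing continuants: each period `1, n` has sum `n + 1`
and multiplies the vector `(K, K')` of the last two continuants by a matrix with dominant
eigenvalue `μₙ`, so the growth rate per unit of the sum is `l = μₙ ^ (1 / (n + 1))`. That no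
sequence does better is shown with a potential. With `q = 1 / μₙ`, let `f` be the minimum of the
two linear functionals `(K, K') ↦ K + (1 - q) K'` and `(K, K') ↦ l ((1 - q) K + q K')`; up to
scaling these are the left eigenvectors of the two cyclic products of the matrices of the entries
`1` and `n`. Appending an entry `a` with `1 ≤ a ≤ n` multiplies `f` by at least `l ^ a`
(`potential_step_two` for `n = 2`, `potential_step` for `n ≥ 3`). As functions of `a`, the
continuants are linear while `l ^ a` is convex, so for `n ≥ 3` only the extreme values of `a`
matter, and these amount to the two estimates `growth_sq_le` and `le_growth_mul`.
Hence `f ≥ l ^ S * f (1, 0)` for a sequence of sum `S`, and `f ≤ l K` on the cone `0 ≤ K' ≤ K`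
gives `K ≥ l ^ (S - 1) / 2`, which is more than the bound in question.
-/

namespace Kan

/-! ### Continuants as a two-term recursion -/

/-- The continuant of a sequence (listed from last to first) with its last entry removed. It is
`0` for the empty sequence, which makes the recursion `continuantRev_cons` hold without
exception. -/
def prevContinuant : List ℕ → ℕ
  | [] => 0
  | _ :: l => continuantRev l

theorem continuantRev_cons (b : ℕ) (L : List ℕ) :
    continuantRev (b :: L) = b * continuantRev L + prevContinuant L := by
  cases L <;> simp [continuantRev, prevContinuant]

theorem prevContinuant_le (L : List ℕ) (h : ∀ a ∈ L, 1 ≤ a) :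
    prevContinuant L ≤ continuantRev L := by
  cases L with
  | nil => simp [prevContinuant]
  | cons b L =>
    rw [continuantRev_cons, prevContinuant]
    have := Nat.mul_le_mul_right (continuantRev L) (h b (by simp))
    omega

/-! ### The potential -/

/-- The minimum of two linear functionals that decides how fast a pair `(x, y)` of consecutive
continuants can grow; it is used with `q = 1 / μₙ` and `l = μₙ ^ (1 / (n + 1))`. -/
noncomputable def potential (q l x y : ℝ) : ℝ :=
  min (x + (1 - q) * y) (l * ((1 - q) * x + q * y))

/-- A linear functional is nonnegative on the cone `0 ≤ y ≤ x` if it is so on its extreme rays. -/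
theorem linear_nonneg_on_cone {α β x y : ℝ} (h0 : 0 ≤ α) (h1 : 0 ≤ α + β) (hy : 0 ≤ y)
    (hxy : y ≤ x) : 0 ≤ α * x + β * y := by
  nlinarith [mul_nonneg h0 (sub_nonneg.2 hxy), mul_nonneg h1 hy]

/-- A multiple of `l ^ a` that is below a linear function at `a = k` and at `a = n` is so in
between, by convexity of `exp`. -/
theorem mul_pow_le_linear {l C α β : ℝ} {k a n : ℕ} (hl : 0 < l) (hC : 0 ≤ C) (hka : k ≤ a)
    (han : a ≤ n) (hk : C * l ^ k ≤ α * k + β) (hn : C * l ^ n ≤ α * n + β) :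
    C * l ^ a ≤ α * a + β := by
  rcases (hka.trans han).eq_or_lt with h | h
  · obtain rfl : a = k := by omega
    exact hk
  have hpow (m : ℕ) : l ^ m = Real.exp (m * Real.log l) := by
    rw [Real.exp_nat_mul, Real.exp_log hl]
  have hd : (0 : ℝ) < n - k := sub_pos.2 (by exact_mod_cast h)
  have hka' : (0 : ℝ) ≤ a - k := sub_nonneg.2 (by exact_mod_cast hka)
  have han' : (0 : ℝ) ≤ n - a := sub_nonneg.2 (by exact_mod_cast han)
  have hconv := convexOn_exp.2 (Set.mem_univ (k * Real.log l)) (Set.mem_univ (n * Real.log l))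
    (div_nonneg han' hd.le) (div_nonneg hka' hd.le) (by field_simp; ring)
  have hmid : ((n : ℝ) - a) / (n - k) * (k * Real.log l) + ((a : ℝ) - k) / (n - k) *
      (n * Real.log l) = a * Real.log l := by
    field_simp
    ring
  simp only [smul_eq_mul, hmid, ← hpow] at hconv
  have hconv' : ((n : ℝ) - k) * l ^ a ≤ (n - a) * l ^ k + (a - k) * l ^ n := by
    have := mul_le_mul_of_nonneg_left hconv hd.le
    field_simp at this
    linarith
  refine le_of_mul_le_mul_left ?_ hd
  nlinarith [mul_le_mul_of_nonneg_left hconv' hC, mul_le_mul_of_nonneg_left hk han',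
    mul_le_mul_of_nonneg_left hn hka']

/-- For `n ≥ 3`, appending an entry `a` with `1 ≤ a ≤ n` multiplies the potential by at least
`l ^ a`. -/
theorem potential_step {n a : ℕ} {q l x y : ℝ} (hn : 3 ≤ n) (ha : 1 ≤ a) (han : a ≤ n)
    (hq0 : 0 < q) (hq : q ≤ 1 / 4) (hl : 1 ≤ l) (hln : l ^ (n + 1) * q = 1)
    (hquad : l ^ (n + 1) = n + 2 - q) (h2 : l ^ 2 * (1 - q) ≤ 2 - q)
    (hg : n + 1 - q ≤ l * (n - (n - 1) * q)) (hy : 0 ≤ y) (hxy : y ≤ x) :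
    l ^ a * potential q l x y ≤ potential q l (a * x + y) x := by
  have hl0 : 0 < l := by linarith
  have hpa : 0 < l ^ a := by positivity
  have hu : potential q l x y ≤ x + (1 - q) * y := min_le_left _ _
  have hw : potential q l x y ≤ l * ((1 - q) * x + q * y) := min_le_right _ _
  have hl2 : l ^ 2 ≤ 3 - 2 * q := by nlinarith
  refine le_min ?_ ?_
  -- the first functional after the step is compared with the second one before it, with
  -- equality at `a = n`
  · have e0 : l * (1 - q) * l ^ a ≤ 1 * a + (1 - q) :=
      mul_pow_le_linear hl0 (by nlinarith) ha han (by norm_num; nlinarith)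
        (by rw [mul_right_comm, ← pow_succ']; linarith)
    have e1 : l * l ^ a ≤ 1 * a + (2 - q) :=
      mul_pow_le_linear hl0 hl0.le ha han (by norm_num; nlinarith)
        (by rw [← pow_succ']; linarith)
    have := linear_nonneg_on_cone (α := a + (1 - q) - l * (1 - q) * l ^ a)
      (β := 1 - l * q * l ^ a) (by linarith) (by linarith) hy hxy
    linarith [mul_le_mul_of_nonneg_left hw hpa.le]
  · rcases ha.eq_or_lt with rfl | ha2
    -- after an entry `1` the second functional is `l` times the first one before it
    · push_cast
      nlinarith [mul_le_mul_of_nonneg_left hu hl0.le]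
    · have hlq : 1 ≤ l * (1 - q) := by
        -- `hg` bounds `l` from below by a number that exceeds `1 / (1 - q)`
        have hn' : (3 : ℝ) ≤ n := by exact_mod_cast hn
        have hd : 0 < n - (n - 1) * q := by nlinarith
        have : (n - (n - 1) * q) * 1 ≤ (n - (n - 1) * q) * (l * (1 - q)) := by
          have := mul_le_mul_of_nonneg_right hg (by linarith : (0 : ℝ) ≤ 1 - q)
          nlinarith
        exact le_of_mul_le_mul_left this hd
      have hn1 : l ^ n * l * (1 - q) = n + 1 - q := by
        rw [← pow_succ]
        linarith
      have e0 : (1 - q) * l ^ a ≤ (1 - q) * a + q := by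
        refine mul_pow_le_linear hl0 (by linarith) ha2 han (by push_cast; linarith) ?_
        refine le_of_mul_le_mul_left ?_ hl0
        linarith
      have e1 : 1 * l ^ a ≤ (1 - q) * a + 1 := by
        refine mul_pow_le_linear hl0 zero_le_one ha2 han (by push_cast; linarith) ?_
        refine le_of_mul_le_mul_left ?_ hl0
        rw [one_mul, ← pow_succ']
        linarith
      have := linear_nonneg_on_cone (α := (1 - q) * a + q - (1 - q) * l ^ a)
        (β := 1 - q - q * l ^ a) (by linarith) (by linarith) hy hxy
      linarith [mul_le_mul_of_nonneg_left hw hpa.le, mul_nonneg hl0.le this]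

/-- For `n = 2` the sequence `2, 2, …` grows almost as slowly as `1, 2, 1, 2, …`, and the
comparison after an entry `2` needs a mixture of both functionals. -/
theorem potential_step_two {a : ℕ} {q l x y : ℝ} (ha : 1 ≤ a) (han : a ≤ 2)
    (hq0 : 26794 / 100000 ≤ q) (hq : q ≤ 26795 / 100000) (hl : 1 ≤ l) (hl' : l ≤ 1552 / 1000)
    (hln : l ^ 3 * q = 1) (hquad : l ^ 3 = 4 - q) (hy : 0 ≤ y) (hxy : y ≤ x) :
    l ^ a * potential q l x y ≤ potential q l (a * x + y) x := by
  have hl0 : 0 < l := by linarith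
  have hu : potential q l x y ≤ x + (1 - q) * y := min_le_left _ _
  have hw : potential q l x y ≤ l * ((1 - q) * x + q * y) := min_le_right _ _
  have hll : l ^ 2 ≤ 2408704 / 1000000 := by nlinarith
  obtain rfl | rfl : a = 1 ∨ a = 2 := by omega
  · push_cast
    refine le_min ?_ ?_
    · have := linear_nonneg_on_cone (α := 2 - q - l) (β := 1 - l * (1 - q)) (by linarith)
        (by nlinarith) hy hxy
      linarith [mul_le_mul_of_nonneg_left hu hl0.le]
    · nlinarith [mul_le_mul_of_nonneg_left hu hl0.le]
  · push_cast
    refine le_min ?_ ?_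
    · have h1 : l ^ 2 * (l * ((1 - q) * x + q * y)) = 2 * x + y + (1 - q) * x := by
        linear_combination x * hquad + (y - x) * hln
      linarith [mul_le_mul_of_nonneg_left hw (sq_nonneg l)]
    · -- the admissible weights of the first functional are roughly those in `[0.15, 0.20]`
      have hmix : potential q l x y ≤ 18 / 100 * (x + (1 - q) * y) +
          82 / 100 * (l * ((1 - q) * x + q * y)) := by linarith
      have e0 : 18 / 100 * l + 82 / 100 * (l ^ 2 * (1 - q)) ≤ 2 - q := by
        nlinarith
      have e1 : 18 / 100 * l * (2 - q) + 82 / 100 * l ^ 2 ≤ 3 - 2 * q := by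
        nlinarith
      have := linear_nonneg_on_cone
        (α := 2 - q - (18 / 100 * l + 82 / 100 * (l ^ 2 * (1 - q))))
        (β := 1 - q - (18 / 100 * l * (1 - q) + 82 / 100 * (l ^ 2 * q)))
        (by linarith) (by linarith) hy hxy
      linarith [mul_le_mul_of_nonneg_left hmix (sq_nonneg l), mul_nonneg hl0.le this]

/-! ### The growth rate -/

theorem mu_sq (n : ℕ) : mu n ^ 2 = (n + 2) * mu n - 1 := by
  have := Real.sq_sqrt (by positivity : (0 : ℝ) ≤ (n : ℝ) ^ 2 + 4 * n)
  unfold mu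
  linarith

theorem add_one_le_mu (n : ℕ) : (n : ℝ) + 1 ≤ mu n := by
  have : (n : ℝ) ≤ Real.sqrt ((n : ℝ) ^ 2 + 4 * n) := by
    apply Real.le_sqrt_of_sq_le
    linarith [n.cast_nonneg (α := ℝ)]
  unfold mu
  linarith

theorem mu_pos (n : ℕ) : 0 < mu n := by
  linarith [add_one_le_mu n, n.cast_nonneg (α := ℝ)]

/-- `1 / μₙ` is the other root of the characteristic polynomial. -/
theorem mu_eq_sub_inv (n : ℕ) : mu n = n + 2 - (mu n)⁻¹ := by
  have h := mu_pos n
  field_simp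
  linarith [mu_sq n]

/-- The growth rate `μₙ ^ (1 / (n + 1))` per unit of the sum. -/
noncomputable def growth (n : ℕ) : ℝ := mu n ^ (1 / ((n : ℝ) + 1))

theorem growth_pow (n : ℕ) : growth n ^ (n + 1) = mu n := by
  have h : (n : ℝ) + 1 ≠ 0 := by positivity
  rw [growth, ← Real.rpow_natCast, ← Real.rpow_mul (mu_pos n).le]
  push_cast
  rw [one_div_mul_cancel h, Real.rpow_one]

theorem one_le_growth (n : ℕ) : 1 ≤ growth n :=
  Real.one_le_rpow (by linarith [add_one_le_mu n, n.cast_nonneg (α := ℝ)]) (by positivity)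

theorem growth_le_of_mu_le {n : ℕ} {r : ℝ} (hr : 0 ≤ r) (h : mu n ≤ r ^ (n + 1)) :
    growth n ≤ r :=
  le_of_pow_le_pow_left₀ n.succ_ne_zero hr ((growth_pow n).trans_le h)

theorem le_growth_of_le_mu {n : ℕ} {r : ℝ} (h : r ^ (n + 1) ≤ mu n) : r ≤ growth n :=
  le_of_pow_le_pow_left₀ n.succ_ne_zero (by linarith [one_le_growth n])
    (h.trans_eq (growth_pow n).symm)

theorem sq_le_two_pow {n : ℕ} (hn : 5 ≤ n) : (n + 2) ^ 2 ≤ 2 ^ (n + 1) := by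
  induction n, hn using Nat.le_induction with
  | base => norm_num
  | succ n hn ih =>
    rw [pow_succ 2]
    nlinarith

theorem inv_mu_bounds {n : ℕ} (hn : 3 ≤ n) :
    0 < (mu n)⁻¹ ∧ (mu n)⁻¹ ≤ 1 / 4 ∧ (n + 7 / 4) * (mu n)⁻¹ ≤ 1 := by
  have hn' : (3 : ℝ) ≤ n := by exact_mod_cast hn
  have h := mu_pos n
  have h4 : (mu n)⁻¹ ≤ 1 / 4 := by
    rw [one_div]
    exact inv_anti₀ (by norm_num) (by linarith [add_one_le_mu n])
  refine ⟨inv_pos.2 h, h4, ?_⟩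
  calc (n + 7 / 4) * (mu n)⁻¹ ≤ mu n * (mu n)⁻¹ := by
        refine mul_le_mul_of_nonneg_right ?_ (inv_pos.2 h).le
        linarith [mu_eq_sub_inv n]
    _ = 1 := mul_inv_cancel₀ h.ne'

/-- The upper bound on the growth rate that the entries `a = 1` and `a = 2` require. -/
theorem growth_sq_le {n : ℕ} (hn : 3 ≤ n) :
    growth n ^ 2 * (1 - (mu n)⁻¹) ≤ 2 - (mu n)⁻¹ := by
  obtain ⟨h0, h4, h7⟩ := inv_mu_bounds hn
  have hmu := mu_eq_sub_inv n
  have hinv := mul_inv_cancel₀ (mu_pos n).ne'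
  have hl := one_le_growth n
  by_cases h5 : 5 ≤ n
  · have hsq : growth n ^ 2 ≤ 2 := by
      refine le_of_pow_le_pow_left₀ n.succ_ne_zero zero_le_two ?_
      rw [← pow_mul, mul_comm, pow_mul, Nat.succ_eq_add_one, growth_pow]
      calc mu n ^ 2 ≤ ((n : ℝ) + 2) ^ 2 :=
            pow_le_pow_left₀ (mu_pos n).le (by linarith) 2
        _ ≤ 2 ^ (n + 1) := by exact_mod_cast sq_le_two_pow h5
    nlinarith
  · obtain rfl | rfl : n = 3 ∨ n = 4 := by omega
    · push_cast at hmu h7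
      have : growth 3 ≤ 3 / 2 := growth_le_of_mu_le (by norm_num) (by norm_num; linarith)
      nlinarith
    · push_cast at hmu h7
      have : growth 4 ≤ 29 / 20 := growth_le_of_mu_le (by norm_num) (by norm_num; linarith)
      nlinarith

/-- The lower bound on the growth rate that the entry `a = n` requires; it makes precise that
repeating `n` is no cheaper than alternating it with `1`. Asymptotically it says that `μₙ` exceeds `e ^ 2`, so small
`n` have to be checked one by one. -/
theorem le_growth_mul {n : ℕ} (hn : 3 ≤ n) :
    n + 1 - (mu n)⁻¹ ≤ growth n * (n - (n - 1) * (mu n)⁻¹) := by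
  obtain ⟨h0, h4, h7⟩ := inv_mu_bounds hn
  have hmu := mu_eq_sub_inv n
  have hn' : (3 : ℝ) ≤ n := by exact_mod_cast hn
  have hd : 0 ≤ n - (n - 1) * (mu n)⁻¹ := by nlinarith
  suffices h : ∃ r : ℝ, r ^ (n + 1) ≤ n + 7 / 4 ∧
      n + 1 - (mu n)⁻¹ ≤ r * (n - (n - 1) * (mu n)⁻¹) by
    obtain ⟨r, hr, h⟩ := h
    exact h.trans (mul_le_mul_of_nonneg_right (le_growth_of_le_mu (by linarith)) hd)
  clear hmu hd
  generalize (mu n)⁻¹ = q at *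
  by_cases h : 7 ≤ n
  · have h7n : (7 : ℝ) ≤ n := by exact_mod_cast h
    have hn1 : (0 : ℝ) < n + 1 := by linarith
    refine ⟨1 + 52 / 25 / (n + 1), ?_, ?_⟩
    · have hexp : (1 + 52 / 25 / ((n : ℝ) + 1)) ^ (n + 1) ≤ Real.exp (52 / 25) := by
        calc (1 + 52 / 25 / ((n : ℝ) + 1)) ^ (n + 1)
            ≤ Real.exp (52 / 25 / (n + 1)) ^ (n + 1) := by
              refine pow_le_pow_left₀ (by positivity) ?_ _
              linarith [Real.add_one_le_exp (52 / 25 / ((n : ℝ) + 1))]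
          _ = Real.exp (52 / 25) := by
              rw [← Real.exp_nat_mul]
              congr 1
              push_cast
              field_simp
      have hsplit : Real.exp (52 / 25) = Real.exp 1 ^ 2 * Real.exp (2 / 25) := by
        rw [← Real.exp_nat_mul, ← Real.exp_add]
        norm_num
      have hsmall : Real.exp (2 / 25) ≤ 25 / 23 := by
        have := Real.one_sub_le_exp_neg (2 / 25)
        rw [Real.exp_neg] at this
        calc Real.exp (2 / 25) ≤ (1 - 2 / 25)⁻¹ :=
              le_inv_of_le_inv₀ (by norm_num) this
          _ = 25 / 23 := by norm_num
      have he : Real.exp 1 ^ 2 ≤ (272 / 100) ^ 2 :=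
        pow_le_pow_left₀ (Real.exp_pos 1).le (by linarith [Real.exp_one_lt_d9]) 2
      have := mul_le_mul he hsmall (Real.exp_pos _).le (by norm_num)
      rw [← hsplit] at this
      norm_num at this
      linarith
    · rw [show 1 + 52 / 25 / ((n : ℝ) + 1) = (n + 77 / 25) / (n + 1) by field_simp; ring,
        div_mul_eq_mul_div, le_div_iff₀ hn1]
      have h1 : 0 ≤ 1 - (n + 1) * q := by nlinarith
      nlinarith [mul_nonneg h1 hn1.le]
  · obtain rfl | rfl | rfl | rfl : n = 3 ∨ n = 4 ∨ n = 5 ∨ n = 6 := by omega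
    · refine ⟨147 / 100, by norm_num, ?_⟩
      push_cast at *
      linarith
    · refine ⟨139 / 100, by norm_num, ?_⟩
      push_cast at *
      linarith
    · refine ⟨133 / 100, by norm_num, ?_⟩
      push_cast at *
      linarith
    · refine ⟨129 / 100, by norm_num, ?_⟩
      push_cast at *
      linarith

/-! ### The lower bound for continuants -/

theorem inv_mu_two_bounds :
    26794 / 100000 ≤ (mu 2)⁻¹ ∧ (mu 2)⁻¹ ≤ 26795 / 100000 := by
  have h := mu_eq_sub_inv 2
  have hm := add_one_le_mu 2
  have hi := mul_inv_cancel₀ (mu_pos 2).ne'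
  have hq : (mu 2)⁻¹ ≤ 1 / 3 := by
    push_cast at hm
    rw [one_div]
    exact inv_anti₀ (by norm_num) (by linarith)
  generalize (mu 2)⁻¹ = q at *
  rw [h] at hi
  push_cast at hi
  constructor <;> nlinarith

theorem pow_mul_potential_le {n a : ℕ} {x y : ℝ} (hn : 2 ≤ n) (ha : 1 ≤ a) (han : a ≤ n)
    (hy : 0 ≤ y) (hxy : y ≤ x) :
    growth n ^ a * potential (mu n)⁻¹ (growth n) x y ≤
      potential (mu n)⁻¹ (growth n) (a * x + y) x := by
  have hln : growth n ^ (n + 1) * (mu n)⁻¹ = 1 := by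
    rw [growth_pow, mul_inv_cancel₀ (mu_pos n).ne']
  have hquad : growth n ^ (n + 1) = n + 2 - (mu n)⁻¹ := by
    rw [growth_pow]
    exact mu_eq_sub_inv n
  rcases hn.eq_or_lt with rfl | hn3
  · obtain ⟨h1, h2⟩ := inv_mu_two_bounds
    have hm := mu_eq_sub_inv 2
    push_cast at hm hquad
    refine potential_step_two ha han h1 h2 (one_le_growth 2) ?_ hln (by linarith) hy hxy
    exact growth_le_of_mu_le (by norm_num) (by norm_num; linarith)
  · obtain ⟨h0, h4, -⟩ := inv_mu_bounds hn3
    exact potential_step hn3 ha han h0 h4 (one_le_growth n) hln hquad (growth_sq_le hn3)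
      (le_growth_mul hn3) hy hxy

theorem growth_pow_sum_le_potential {n : ℕ} (hn : 2 ≤ n) (L : List ℕ)
    (hL : ∀ a ∈ L, 1 ≤ a ∧ a ≤ n) :
    growth n ^ L.sum * potential (mu n)⁻¹ (growth n) 1 0 ≤
      potential (mu n)⁻¹ (growth n) (continuantRev L) (prevContinuant L) := by
  induction L with
  | nil => simp [continuantRev, prevContinuant]
  | cons b L ih =>
    have hL' : ∀ a ∈ L, 1 ≤ a ∧ a ≤ n := fun a ha => hL a (by simp [ha])
    obtain ⟨hb, hbn⟩ := hL b (by simp)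
    rw [List.sum_cons, pow_add, mul_assoc, continuantRev_cons]
    push_cast
    refine (mul_le_mul_of_nonneg_left (ih hL') ?_).trans
      (pow_mul_potential_le hn hb hbn (Nat.cast_nonneg _) ?_)
    · exact pow_nonneg (zero_le_one.trans (one_le_growth n)) b
    · exact_mod_cast prevContinuant_le L fun a ha => (hL' a ha).1

theorem lowerBound_le_continuant {n : ℕ} (hn : 2 ≤ n) (L : List ℕ)
    (hL : ∀ a ∈ L, 1 ≤ a ∧ a ≤ n) : lowerBound n L.sum ≤ continuant L := by
  have hn' : (2 : ℝ) ≤ n := by exact_mod_cast hn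
  have hl := one_le_growth n
  have hl0 : 0 < growth n := by linarith
  have hq0 : 0 < (mu n)⁻¹ := inv_pos.2 (mu_pos n)
  have hq : (mu n)⁻¹ ≤ 1 / 2 := by
    rw [one_div]
    exact inv_anti₀ (by norm_num) (by linarith [add_one_le_mu n])
  have hR : ∀ a ∈ L.reverse, 1 ≤ a ∧ a ≤ n := fun a ha => hL a (List.mem_reverse.1 ha)
  have hmain := growth_pow_sum_le_potential hn L.reverse hR
  rw [List.sum_reverse] at hmain
  have hprev : (prevContinuant L.reverse : ℝ) ≤ continuant L := by
    exact_mod_cast prevContinuant_le L.reverse fun a ha => (hR a ha).1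
  have hinit : 1 / 2 ≤ potential (mu n)⁻¹ (growth n) 1 0 :=
    le_min (by linarith) (by nlinarith)
  have hup : potential (mu n)⁻¹ (growth n) (continuantRev L.reverse)
      (prevContinuant L.reverse) ≤ growth n * continuant L := by
    refine (min_le_right _ _).trans (mul_le_mul_of_nonneg_left ?_ hl0.le)
    have := mul_le_mul_of_nonneg_left hprev hq0.le
    rw [continuant] at *
    linarith
  have hK : growth n ^ ((L.sum : ℝ) - 1) / 2 ≤ continuant L := by
    refine le_of_mul_le_mul_left ?_ hl0
    rw [Real.rpow_sub_one hl0.ne', Real.rpow_natCast]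
    calc growth n * (growth n ^ L.sum / growth n / 2) = growth n ^ L.sum * (1 / 2) := by
          field_simp
      _ ≤ _ := (mul_le_mul_of_nonneg_left hinit (by positivity)).trans (hmain.trans hup)
  refine le_trans ?_ hK
  have he : (2 : ℝ) ≤ Real.exp 1 ^ 2 := by nlinarith [Real.add_one_le_exp 1]
  exact div_le_div₀ (by positivity)
    (Real.rpow_le_rpow_of_exponent_le hl (by linarith)) two_pos he

/-! ### The case `n = 4` -/

theorem lt_mu_four : 582842 / 100000 < mu 4 := by
  have : (565684 / 100000 : ℝ) < Real.sqrt ((4 : ℕ) ^ 2 + 4 * (4 : ℕ)) := by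
    apply Real.lt_sqrt_of_sq_lt
    norm_num
  unfold mu
  push_cast at *
  linarith

theorem sqrt_pow_ten_mul_le :
    Real.sqrt (2 + 1 / 10 ^ 6) ^ 10 * (106157 / 100000) ≤ growth 4 ^ 10 := by
  have h1 : growth 4 ^ 10 = mu 4 ^ 2 := by
    rw [← growth_pow 4, ← pow_mul]
  have h2 : Real.sqrt (2 + 1 / 10 ^ 6) ^ 10 = (2 + 1 / 10 ^ 6) ^ 5 := by
    rw [show 10 = 2 * 5 from rfl, pow_mul, Real.sq_sqrt (by norm_num)]
  have h3 := pow_le_pow_left₀ (by norm_num) lt_mu_four.le 2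
  rw [h1, h2]
  refine le_trans ?_ h3
  norm_num

theorem sqrt_lt_growth_four : Real.sqrt (2 + 1 / 10 ^ 6) < growth 4 := by
  have : 0 < Real.sqrt (2 + 1 / 10 ^ 6) := by positivity
  refine lt_of_pow_lt_pow_left₀ 10 (by linarith [one_le_growth 4])
    (lt_of_lt_of_le ?_ sqrt_pow_ten_mul_le)
  linarith [pow_pos this 10]

set_option exponentiation.threshold 600 in
/-- The instance `S = 512` of the comparison, cleared of denominators. It holds by a margin of
about two per thousand and is checked on tenth powers. -/
theorem sqrt_pow_mul_exp_lt :
    Real.sqrt (2 + 1 / 10 ^ 6) ^ 512 * Real.exp 1 ^ 2 < growth 4 ^ 509 := by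
  set c := Real.sqrt (2 + 1 / 10 ^ 6) with hc
  have hc0 : 0 < c := by positivity
  have hg0 : 0 < growth 4 := by linarith [one_le_growth 4]
  have hc2 : c ^ 2 = 2 + 1 / 10 ^ 6 := Real.sq_sqrt (by norm_num)
  refine lt_of_pow_lt_pow_left₀ 10 (by positivity) ?_
  have he : Real.exp 1 ^ 20 ≤ (27183 / 10000) ^ 20 :=
    pow_le_pow_left₀ (Real.exp_pos 1).le (by linarith [Real.exp_one_lt_d9]) 20
  have hpow := pow_le_pow_left₀ (by positivity) sqrt_pow_ten_mul_le 509
  have hnum : (2 + 1 / 10 ^ 6 : ℝ) ^ 15 * (27183 / 10000) ^ 20 < (106157 / 100000) ^ 509 := by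
    norm_num
  calc (c ^ 512 * Real.exp 1 ^ 2) ^ 10
      = (c ^ 10) ^ 509 * ((c ^ 2) ^ 15 * Real.exp 1 ^ 20) := by
        simp only [mul_pow, ← pow_mul, ← mul_assoc, ← pow_add]
    _ ≤ (c ^ 10) ^ 509 * ((2 + 1 / 10 ^ 6) ^ 15 * (27183 / 10000) ^ 20) := by
        rw [hc2]
        gcongr
    _ < (c ^ 10) ^ 509 * (106157 / 100000) ^ 509 :=
        mul_lt_mul_of_pos_left hnum (by positivity)
    _ = (c ^ 10 * (106157 / 100000)) ^ 509 := (mul_pow _ _ _).symm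
    _ ≤ (growth 4 ^ 10) ^ 509 := hpow
    _ = (growth 4 ^ 509) ^ 10 := pow_right_comm _ _ _

theorem sqrt_pow_lt_lowerBound {S : ℕ} (hS : 512 ≤ S) :
    Real.sqrt (2 + 1 / 10 ^ 6) ^ S < lowerBound 4 S := by
  have hg0 : 0 < growth 4 := by linarith [one_le_growth 4]
  have hexp : ((S : ℝ) - (4 : ℕ) + 1) = ((S - 3 : ℕ) : ℝ) := by
    rw [Nat.cast_sub (by omega)]
    push_cast
    ring
  rw [lowerBound, ← growth, hexp, Real.rpow_natCast, lt_div_iff₀ (by positivity)]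
  obtain ⟨k, rfl⟩ := Nat.exists_eq_add_of_le hS
  rw [show 512 + k - 3 = 509 + k by omega, pow_add, pow_add, mul_right_comm]
  exact mul_lt_mul sqrt_pow_mul_exp_lt
    (pow_le_pow_left₀ (by positivity) sqrt_lt_growth_four.le k) (by positivity) (by positivity)

end Kan

theorem corollary1 :
    -- the minimum over all sequences exists and satisfies the bound
    (∀ n S : ℕ, 2 ≤ n → n + 2 ≤ S →
      ∃ M : ℕ, IsLeast (Kan.continuant '' Kan.sumBoundedSeqs n S) M ∧
        Kan.lowerBound n S ≤ (M : ℝ)) ∧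
    -- for n = 4 the growth rate is larger than the one used before,
    Real.sqrt (2 + 1 / 10 ^ 6) < Kan.mu 4 ^ ((1 : ℝ) / 5) ∧
    -- and the new bound itself exceeds the previous one for all large S
    (∀ S : ℕ, 512 ≤ S →
      Real.sqrt (2 + 1 / 10 ^ 6) ^ S < Kan.lowerBound 4 S) := by
  refine ⟨fun n S hn _ => ?_, ?_, fun S hS => Kan.sqrt_pow_lt_lowerBound hS⟩
  · have hne : (Kan.continuant '' Kan.sumBoundedSeqs n S).Nonempty := by
      refine ⟨_, List.replicate S 1, Set.mem_iUnion.2 ⟨S, by simp, fun a ha => ?_, by simp⟩, rfl⟩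
      rw [List.eq_of_mem_replicate ha]
      omega
    refine ⟨sInf _, ⟨Nat.sInf_mem hne, fun _ h => Nat.sInf_le h⟩, ?_⟩
    obtain ⟨L, hL, hmin⟩ := Nat.sInf_mem hne
    obtain ⟨t, -, hmem, hsum⟩ := Set.mem_iUnion.1 hL
    rw [← hmin, ← hsum]
    exact Kan.lowerBound_le_continuant hn L hmem
  · have := Kan.sqrt_lt_growth_four
    rw [Kan.growth] at this
    norm_num at this ⊢
    exact this
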